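/- All relational structures are finite (possibly empty) and have a finite relational signature. Monadic second-order logic (MSO) over a signature is built from the atomic formulae $X\subseteq Y$ and $R Z_0\dots Z_{k-1}$ (meaning: there are $a_i\in Z_i$ with $(a_0,\dots,a_{k-1})\in R$) by Boolean connectives and quantification over set variables; an element $a$ substituted for a variable is read as the singleton $\{a\}$. A basic MSO-transduction $\tau_0=\langle\chi,\delta(x),(\varphi_R(\bar x))_R\rangle$ is given by MSO-formulae, one formula $\varphi_R$ for each symbol $R$ of the target signature. It maps each structure $\mathfrak A$ with $\mathfrak A\models\chi$ to the structure with domain $D=\{a\in A : \mathfrak A\models\delta(a)\}$ and relations $\{\bar a\in D^{\mathrm{ar}(R)} : \mathfrak A\models\varphi_R(\bar a)\}$; it is undefined on all other structures. For $m\ge 0$, $\mathrm{exp}_m$ is the many-valued operation that maps $\mathfrak A$ to all its expansions by $m$ unary predicates. For $k\geq 2$, $\mathrm{copy}_k$ maps $\mathfrak A$ to the disjoint union of $k$ copies of $\mathfrak A$, expanded by the equivalence relation of being copies of the same element and by $k$ unary predicates for the $k$ components; $\mathrm{copy}_1$ is the identity. An MSO-transduction is a many-valued operation of the form $\tau=\tau_0\circ\mathrm{copy}_k\circ\mathrm{exp}_m$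 with $k\ge 1$, $m\geq 0$ and $\tau_0$ a basic MSO-transduction. We write $\tau(\mathcal K)$ for the class of all values of $\tau$ at structures in $\mathcal K$. The incidence structure of $\mathfrak A=\langle A,R_0,\dots,R_{s-1}\rangle$ is $\mathfrak A_{\mathrm{in}}=\langle A\sqcup E,P_{R_0},\dots,P_{R_{s-1}},\mathrm{in}_0,\dots,\mathrm{in}_{r-1}\rangle$, where $E=R_0\cup\dots\cup R_{s-1}$, $r$ is the maximal arity of the $R_i$, $P_{R_i}=\{\bar c\in E:\bar c\in R_i\}$, and $\mathrm{in}_i=\{(a,\bar c)\in A\times E : |\bar c|>i,\ a=c_i\}$. For a class $\mathcal C$ of structures put $\mathcal C_{\mathrm{in}}=\{\mathfrak A_{\mathrm{in}}:\mathfrak A\in\mathcal C\}$. For classes $\mathcal C,\mathcal K$ of structures, $\mathcal C\sqsubseteq_{\mathrm{in}}\mathcal K$ means that there is an MSO-transduction $\tau$ such that $\mathcal C_{\mathrm{in}}\subseteq\tau(\mathcal K_{\mathrm{in}})$ up to isomorphism, i.e. every structure in $\mathcal C_{\mathrm{in}}$ is isomorphic to one in $\tau(\mathcal K_{\mathrm{in}})$;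 and $\mathcal C\sqsubset_{\mathrm{in}}\mathcal K$ means that $\mathcal C\sqsubseteq_{\mathrm{in}}\mathcal K$ and $\mathcal K\not\sqsubseteq_{\mathrm{in}}\mathcal C$. For $n\in\mathbb N$, let $\mathcal T_n=\{m^{<n}: m\in\mathbb N\}$, where $m^{<n}$ is the complete $m$-ary tree of height $n$: the directed graph whose vertices are all sequences over $\{0,\dots,m-1\}$ of length less than $n$, with an edge from $x$ to $xd$ whenever both are vertices and $d<m$. (So $m^{<0}$ is empty and $m^{<1}$ is a single vertex.) **Theorem.** For every $n\in\mathbb N$, $\mathcal T_n\sqsubset_{\mathrm{in}}\mathcal T_{n+1}$. That is, $\mathcal T_n\sqsubseteq_{\mathrm{in}}\mathcal T_{n+1}$, and there is no MSO-transduction $\tau$ such that every structure in $(\mathcal T_{n+1})_{\mathrm{in}}$ is isomorphic to one in $\tau((\mathcal T_n)_{\mathrm{in}})$. -/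

import Mathlib

namespace MSOTrans

open FirstOrder FirstOrder.Language

/-- A finite structure over the language `L` (the domain may be empty). -/
structure FinStr (L : FirstOrder.Language.{0, 0}) where
  Dom : Type
  [str : L.Structure Dom]
  [fin : Finite Dom]

attribute [instance] FinStr.str FinStr.fin

/-! ### Monadic second-order logic -/

/-- Monadic second-order formulae over the relation symbols of `L` with the free set variables
`X₀, …, X_{n-1}`. There are only set variables. The atomic formulae are `Xᵢ ⊆ Xⱼ` and
`R X_{z 0} … X_{z (k-1)}`. The quantifier `ex` binds the last variable of its argument. -/
inductive MSO (L : FirstOrder.Language.{0, 0}) : ℕ → Type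
  | subset {n : ℕ} (i j : Fin n) : MSO L n
  | rel {n k : ℕ} (R : L.Relations k) (z : Fin k → Fin n) : MSO L n
  | neg {n : ℕ} (φ : MSO L n) : MSO L n
  | and {n : ℕ} (φ ψ : MSO L n) : MSO L n
  | ex {n : ℕ} (φ : MSO L (n + 1)) : MSO L n

/-- Satisfaction of a formula in a structure, where `X` interprets the free set variables.
`R Z₀ … Z_{k-1}` says that some tuple in `R` has its `i`-th entry in `Zᵢ`, for all `i`. -/
def MSO.Sat {L : FirstOrder.Language.{0, 0}} {A : Type} [L.Structure A] :
    {n : ℕ} → MSO L n → (Fin n → Set A) → Prop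
  | _, .subset i j, X => X i ⊆ X j
  | _, .rel R z, X => ∃ a : Fin _ → A, (∀ i, a i ∈ X (z i)) ∧ Structure.RelMap R a
  | _, .neg φ, X => ¬ φ.Sat X
  | _, .and φ ψ, X => φ.Sat X ∧ ψ.Sat X
  | _, .ex φ, X => ∃ Y : Set A, φ.Sat (Fin.snoc X Y)

/-- `A ⊨ φ(a₀, …, a_{n-1})` for elements `aᵢ`, which are regarded as singleton sets. -/
def MSO.Holds {L : FirstOrder.Language.{0, 0}} {A : Type} [L.Structure A] {n : ℕ}
    (φ : MSO L n) (a : Fin n → A) : Prop :=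
  φ.Sat fun i => {a i}

/-! ### Transductions -/

/-- The relation symbols of `Lang.params m`: `m` unary ones. -/
inductive ParamRel (m : ℕ) : ℕ → Type
  | pred (i : Fin m) : ParamRel m 1

/-- The language of the `m` unary predicates (parameters) `Q₀, …, Q_{m-1}`. -/
def paramLang (m : ℕ) : FirstOrder.Language.{0, 0} := ⟨fun _ => Empty, ParamRel m⟩

instance (m : ℕ) : (paramLang m).IsRelational := fun _ => inferInstanceAs (IsEmpty Empty)

/-- One of the expansions of `A` that make up `exp_m A`: the one by the unary predicates `Q`. -/
def expand {L : FirstOrder.Language.{0, 0}} {m : ℕ} (A : FinStr L) (Q : Fin m → Set A.Dom) :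
    FinStr (L.sum (paramLang m)) :=
  letI : (paramLang m).Structure A.Dom :=
    { funMap := fun f => isEmptyElim f
      RelMap := fun R => match R with
        | .pred i => fun x => x 0 ∈ Q i }
  { Dom := A.Dom }

/-- The relation symbols added by the operation `copy_k`. There are none for `k = 1`. -/
inductive CopyRel (k : ℕ) : ℕ → Type
  | same (h : 2 ≤ k) : CopyRel k 2
  | part (h : 2 ≤ k) (i : Fin k) : CopyRel k 1

/-- The language `{∼, P₀, …, P_{k-1}}` for `k ≥ 2`, and the empty language for `k ≤ 1`. -/
def copyLang (k : ℕ) : FirstOrder.Language.{0, 0} := ⟨fun _ => Empty, CopyRel k⟩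

instance (k : ℕ) : (copyLang k).IsRelational := fun _ => inferInstanceAs (IsEmpty Empty)

/-- The operation `copy_k`: the disjoint union of `k` copies of `A`, expanded (if `k ≥ 2`) by the
relation `∼` between copies of the same element and by predicates for the components. -/
def copy {L : FirstOrder.Language.{0, 0}} [L.IsRelational] (k : ℕ) (A : FinStr L) :
    FinStr (L.sum (copyLang k)) :=
  letI : L.Structure (A.Dom × Fin k) :=
    { funMap := fun f => isEmptyElim f
      RelMap := fun {n} R x =>
        ∃ (i : Fin k) (a : Fin n → A.Dom), Structure.RelMap R a ∧ x = fun j => (a j, i) }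
  letI : (copyLang k).Structure (A.Dom × Fin k) :=
    { funMap := fun f => isEmptyElim f
      RelMap := fun R => match R with
        | .same _ => fun x => (x 0).1 = (x 1).1
        | .part _ i => fun x => (x 0).2 = i }
  { Dom := A.Dom × Fin k }

/-- The definition scheme `⟨χ, δ(x), (φ_R(x̄))_R⟩` of a basic MSO-transduction from structures over
the relational language `L` to structures over the finite relational language `L'`. -/
structure BasicTransduction (L L' : FirstOrder.Language.{0, 0}) [L.IsRelational] [L'.IsRelational]
    [Finite L'.Symbols] where
  χ : MSO L 0
  δ : MSO L 1
  φ : {n : ℕ} → L'.Relations n → MSO L n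

section
variable {L L' : FirstOrder.Language.{0, 0}} [L.IsRelational] [L'.IsRelational] [Finite L'.Symbols]

/-- `τ(A)` is defined if and only if `A` satisfies the sentence `χ`. -/
def BasicTransduction.Defined (τ : BasicTransduction L L') (A : FinStr L) : Prop :=
  τ.χ.Holds (Fin.elim0 : Fin 0 → A.Dom)

/-- The structure `τ(A)` (which is meaningful if `τ.Defined A`): its domain consists of the
elements that satisfy `δ`, and its relations are defined by the formulae `φ`, evaluated in `A`. -/
def BasicTransduction.apply (τ : BasicTransduction L L') (A : FinStr L) : FinStr L' :=
  letI : L'.Structure {a : A.Dom // τ.δ.Holds ![a]} :=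
    { funMap := fun f => isEmptyElim f
      RelMap := fun R x => (τ.φ R).Holds fun i => (x i : A.Dom) }
  { Dom := {a : A.Dom // τ.δ.Holds ![a]} }

end

/-- An MSO-transduction `τ₀ ∘ copy_k ∘ exp_m` with `k ≥ 1`. -/
structure Transduction (L L' : FirstOrder.Language.{0, 0}) [L.IsRelational] [L'.IsRelational]
    [Finite L'.Symbols] where
  k : ℕ
  one_le_k : 1 ≤ k
  m : ℕ
  basic : BasicTransduction ((L.sum (paramLang m)).sum (copyLang k)) L'

section
variable {L L' : FirstOrder.Language.{0, 0}} [L.IsRelational] [L'.IsRelational] [Finite L'.Symbols]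

/-- The set `τ(A)` of all values of the many-valued operation `τ` at `A`. -/
def Transduction.values (τ : Transduction L L') (A : FinStr L) : Set (FinStr L') :=
  {B | ∃ Q : Fin τ.m → Set A.Dom, τ.basic.Defined (copy τ.k (expand A Q)) ∧
    B = τ.basic.apply (copy τ.k (expand A Q))}

/-- `τ(K)`, for a class `K` of structures. -/
def Transduction.image (τ : Transduction L L') (K : Set (FinStr L)) : Set (FinStr L') :=
  ⋃ A ∈ K, τ.values A

/-- `C ⊑ K`: there is a transduction `τ` with `C ⊆ τ(K)`, structures being identified if they are
isomorphic. -/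
def Below (C : Set (FinStr L')) (K : Set (FinStr L)) : Prop :=
  ∃ τ : Transduction L L', ∀ B ∈ C, ∃ B' ∈ τ.image K, Nonempty (B.Dom ≃[L'] B'.Dom)

end

/-! ### Incidence structures -/

/-- The relation symbols of incidence structures: a unary symbol `P_R` for every relation symbol
`R` of `L`, and binary symbols `in_i` for all `i` below the maximal arity of a symbol of `L`. -/
inductive IncRel (L : FirstOrder.Language.{0, 0}) : ℕ → Type
  | pred {n : ℕ} (R : L.Relations n) : IncRel L 1
  | inc (i : ℕ) (h : ∃ n, i < n ∧ Nonempty (L.Relations n)) : IncRel L 2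

/-- The language of the incidence structures of `L`-structures. -/
def incLang (L : FirstOrder.Language.{0, 0}) : FirstOrder.Language.{0, 0} := ⟨fun _ => Empty, IncRel L⟩

instance (L : FirstOrder.Language.{0, 0}) : (incLang L).IsRelational :=
  fun _ => inferInstanceAs (IsEmpty Empty)

instance (L : FirstOrder.Language.{0, 0}) [Finite L.Symbols] : Finite (incLang L).Symbols := by
  have hR : Finite (Σ n, L.Relations n) := Finite.of_injective
    (Sum.inr : _ → L.Symbols) Sum.inr_injective
  have hJ : Finite (Σ s : (Σ n, L.Relations n), Fin s.1) := inferInstance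
  have h1 : Finite (Σ n, IncRel L n) := by
    let f : (Σ n, L.Relations n) ⊕ (Σ s : (Σ n, L.Relations n), Fin s.1) → Σ n, IncRel L n :=
      Sum.elim (fun s => ⟨1, .pred s.2⟩)
        (fun t => ⟨2, .inc t.2 ⟨t.1.1, t.2.2, ⟨t.1.2⟩⟩⟩)
    refine Finite.of_surjective f ?_
    rintro ⟨_, (⟨R⟩ | ⟨i, h⟩)⟩
    · exact ⟨Sum.inl ⟨_, R⟩, rfl⟩
    · obtain ⟨n, hi, ⟨R⟩⟩ := id h
      exact ⟨Sum.inr ⟨⟨n, R⟩, ⟨i, hi⟩⟩, rfl⟩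
  have h0 : IsEmpty (Σ n, (incLang L).Functions n) := isEmpty_sigma.2 fun _ => inferInstance
  have h2 : Finite (Σ n, (incLang L).Relations n) := h1
  exact inferInstanceAs (Finite (_ ⊕ _))

/-- The set `E` of all tuples that belong to some relation of `A`. -/
def Tuples {L : FirstOrder.Language.{0, 0}} (A : FinStr L) : Type :=
  {c : Σ n, Fin n → A.Dom // ∃ R : L.Relations c.1, Structure.RelMap R c.2}

instance {L : FirstOrder.Language.{0, 0}} [Finite L.Symbols] (A : FinStr L) : Finite (Tuples A) := by
  have hR : Finite (Σ n, L.Relations n) := Finite.of_injective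
    (Sum.inr : _ → L.Symbols) Sum.inr_injective
  have hJ : Finite (Σ s : (Σ n, L.Relations n), (Fin s.1 → A.Dom)) := inferInstance
  let g : Tuples A → Σ s : (Σ n, L.Relations n), (Fin s.1 → A.Dom) :=
    fun c => ⟨⟨c.1.1, c.2.choose⟩, c.1.2⟩
  refine Finite.of_injective g ?_
  rintro ⟨⟨n, c⟩, hc⟩ ⟨⟨n', c'⟩, hc'⟩ h
  have h1 : n = n' := congrArg (fun t => t.1.1) h
  subst h1
  have h2 : c = c' := by
    simp only [g, Sigma.mk.injEq] at h
    exact eq_of_heq h.2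
  subst h2
  rfl

/-- The incidence structure of `A`, with domain `A ⊔ E`. -/
def incidence {L : FirstOrder.Language.{0, 0}} [Finite L.Symbols] (A : FinStr L) : FinStr (incLang L) :=
  letI : (incLang L).Structure (A.Dom ⊕ Tuples A) :=
    { funMap := fun f => isEmptyElim f
      RelMap := fun R => match R with
        | .pred (n := n) R => fun x => ∃ (c : Fin n → A.Dom) (h : Structure.RelMap R c),
            x 0 = .inr ⟨⟨n, c⟩, ⟨R, h⟩⟩
        | .inc i _ => fun x => ∃ (e : Tuples A) (h : i < e.1.1),
            x 0 = .inl (e.1.2 ⟨i, h⟩) ∧ x 1 = .inr e }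
  { Dom := A.Dom ⊕ Tuples A }

section
variable {L L' : FirstOrder.Language.{0, 0}} [L.IsRelational] [L'.IsRelational]
  [Finite L.Symbols] [Finite L'.Symbols]

/-- `C ⊑_in K`. -/
def BelowIn (C : Set (FinStr L')) (K : Set (FinStr L)) : Prop :=
  Below (incidence '' C) (incidence '' K)

/-- `C ⊏_in K`. -/
def StrictlyBelowIn (C : Set (FinStr L')) (K : Set (FinStr L)) : Prop :=
  BelowIn C K ∧ ¬ BelowIn K C

end

/-! ### Complete trees -/

instance : Finite FirstOrder.Language.graph.Symbols := by
  have h0 : IsEmpty (Σ n, FirstOrder.Language.graph.Functions n) := isEmpty_sigma.2 fun _ => inferInstance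
  have h1 : Finite (Σ n, FirstOrder.Language.graph.Relations n) :=
    Finite.of_surjective (fun _ : Unit => ⟨2, .adj⟩) fun ⟨_, .adj⟩ => ⟨(), rfl⟩
  exact inferInstanceAs (Finite (_ ⊕ _))

/-- The complete `m`-ary tree of height `n`, as a successor-tree: its vertices are the sequences
over `{0, …, m-1}` of length less than `n`, and there is a (directed) edge from `x` to each `xd`.
So the height counts levels: the tree is empty for `n = 0` and a single vertex for `n = 1`. -/
def completeTree (m n : ℕ) : FinStr FirstOrder.Language.graph :=
  letI : FirstOrder.Language.graph.Structure {w : List (Fin m) // w.length < n} :=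
    { funMap := fun f => isEmptyElim f
      RelMap := fun R => match R with
        | .adj => fun x => ∃ d : Fin m, (x 1).1 = (x 0).1 ++ [d] }
  haveI : Finite {w : List (Fin m) // w.length < n} := (List.finite_length_lt (Fin m) n).to_subtype
  { Dom := {w : List (Fin m) // w.length < n} }

/-- The class `T_n` of all complete trees of height `n`. -/
def completeTrees (n : ℕ) : Set (FinStr FirstOrder.Language.graph) :=
  {A | ∃ m : ℕ, A = completeTree m n}

end MSOTrans

namespace MSOTrans

open FirstOrder FirstOrder.Language

/-! Guessing a subset and restricting to it gives `⊑`, since the incidence structure of a tree of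
height `n` embeds into that of the tree of height `n + 1` with the same degree. Strictness rests on
a measure akin to tree-depth, `Shallow`, applied to the tree with every edge subdivided, oriented
away from the root.

If the degree exceeds the number `c` of deletions per round, some child's subtree loses nothing in a
round and, being connected, stays within one part. So a tree of height `n + 1` is not exhausted
after `n` rounds (`not_shallow_of_tree`).

Conversely, let a transduction produce such a subdivided tree from an input tree of height `n`. Then
`n` rounds suffice, with `c` depending on the transduction only. The rounds descend the input tree:
a vertex `u` splits it into one block for each child and one block for the rest. By composition of
types, if there is an output edge from `x` to `y` in another block, then `x` may be replaced by any
element of equal type outside the block of `y` (`setType_univ_eq_of_elementType_eq`). As output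
elements have at most one predecessor, each of the finitely many types contains at most two sources
of edges between blocks (`ncard_cross_sources_le`). Deleting these and the elements at `u` leaves
only edges inside the blocks of the children (`shallow_of_cover`, `shallow_formulaSucc`). -/

/-! ### Types of set tuples relative to a part of a structure -/

/-- Atomic types of `n`-tuples of sets, for binary relations indexed by `S` and colours in `M`. -/
abbrev AtomicType (S M : Type) (n : ℕ) : Type :=
  Set (Fin n × Fin n) × Set (S × Fin n × Fin n) × Set (M × Fin n)

/-- Types of quantifier rank `q` of `n`-tuples of sets. -/
def SetType (S M : Type) : ℕ → ℕ → Type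
  | 0, n => AtomicType S M n
  | q + 1, n => AtomicType S M n × Set (SetType S M q (n + 1))

/-- The number of types does not depend on any structure. This is where the uniform constant of the
whole argument comes from. -/
instance SetType.finite (S M : Type) [Finite S] [Finite M] :
    ∀ q n, Finite (SetType S M q n)
  | 0, n => inferInstanceAs (Finite (AtomicType S M n))
  | q + 1, n =>
    have := SetType.finite S M q (n + 1)
    inferInstanceAs (Finite (AtomicType S M n × Set (SetType S M q (n + 1))))

section Types
variable {D S M I : Type} (R : S → D → D → Prop) (μ : D → M)

/-- The atomic type of a tuple of sets in the part `P`. -/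
def atomicType (P : Set D) {n : ℕ} (X : Fin n → Set D) : AtomicType S M n :=
  ({p | ∀ a ∈ P, a ∈ X p.1 → a ∈ X p.2},
    {p | ∃ a ∈ P, ∃ b ∈ P, a ∈ X p.2.1 ∧ b ∈ X p.2.2 ∧ R p.1 a b},
    {p | ∃ a ∈ P, a ∈ X p.2 ∧ μ a = p.1})

/-- The type of quantifier rank `q` of a tuple of sets in the part `P`. -/
def setType : (q : ℕ) → (P : Set D) → {n : ℕ} → (X : Fin n → Set D) → SetType S M q n
  | 0, P, _, X => atomicType R μ P X
  | q + 1, P, _, X => (atomicType R μ P X, {t | ∃ Y : Set D, t = setType q P (Fin.snoc X Y)})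

variable {R μ}

theorem atomicType_eq_of_setType_eq {q n : ℕ} {P P' : Set D} {X X' : Fin n → Set D}
    (h : setType R μ q P X = setType R μ q P' X') :
    atomicType R μ P X = atomicType R μ P' X' := by
  cases q with
  | zero => exact h
  | succ q => exact congrArg Prod.fst h

theorem exists_setType_snoc_eq {q n : ℕ} {P P' : Set D} {X X' : Fin n → Set D}
    (h : setType R μ (q + 1) P X = setType R μ (q + 1) P' X') (Y : Set D) :
    ∃ Y', setType R μ q P (Fin.snoc X Y : Fin (n + 1) → Set D) =
      setType R μ q P' (Fin.snoc X' Y' : Fin (n + 1) → Set D) := by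
  have h2 := congrArg Prod.snd h
  have : setType R μ q P (Fin.snoc X Y : Fin (n + 1) → Set D) ∈
      {t | ∃ Y : Set D, t = setType R μ q P' (Fin.snoc X' Y : Fin (n + 1) → Set D)} := by
    rw [show {t | ∃ Y : Set D, t = setType R μ q P' (Fin.snoc X' Y : Fin (n + 1) → Set D)} =
      {t | ∃ Y : Set D, t = setType R μ q P (Fin.snoc X Y : Fin (n + 1) → Set D)} from h2.symm]
    exact ⟨Y, rfl⟩
  exact this

theorem setType_succ_eq {q n : ℕ} {P P' : Set D} {X X' : Fin n → Set D}
    (h0 : atomicType R μ P X = atomicType R μ P' X')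
    (h1 : ∀ Y, ∃ Y', setType R μ q P (Fin.snoc X Y : Fin (n + 1) → Set D) =
      setType R μ q P' (Fin.snoc X' Y' : Fin (n + 1) → Set D))
    (h2 : ∀ Y', ∃ Y, setType R μ q P (Fin.snoc X Y : Fin (n + 1) → Set D) =
      setType R μ q P' (Fin.snoc X' Y' : Fin (n + 1) → Set D)) :
    setType R μ (q + 1) P X = setType R μ (q + 1) P' X' := by
  refine Prod.ext h0 (Set.ext fun t => ⟨?_, ?_⟩)
  · rintro ⟨Y, rfl⟩
    exact h1 Y
  · rintro ⟨Y', rfl⟩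
    obtain ⟨Y, h⟩ := h2 Y'
    exact ⟨Y, h.symm⟩

theorem snoc_agree {n : ℕ} {P : Set D} {X X' : Fin n → Set D} {Y Y' : Set D}
    (h : ∀ i, ∀ a ∈ P, a ∈ X i ↔ a ∈ X' i) (hY : ∀ a ∈ P, a ∈ Y ↔ a ∈ Y') :
    ∀ i, ∀ a ∈ P, a ∈ (Fin.snoc X Y : Fin (n + 1) → Set D) i ↔
      a ∈ (Fin.snoc X' Y' : Fin (n + 1) → Set D) i := by
  intro i
  induction i using Fin.lastCases with
  | last => simpa using hY
  | cast i => simpa using h i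

/-- The type in `P` depends only on the traces of the sets on `P`. -/
theorem setType_congr {q n : ℕ} {P : Set D} {X X' : Fin n → Set D}
    (h : ∀ i, ∀ a ∈ P, a ∈ X i ↔ a ∈ X' i) : setType R μ q P X = setType R μ q P X' := by
  have h0 {n : ℕ} {X X' : Fin n → Set D} (h : ∀ i, ∀ a ∈ P, a ∈ X i ↔ a ∈ X' i) :
      atomicType R μ P X = atomicType R μ P X' := by
    refine Prod.ext ?_ (Prod.ext ?_ ?_) <;> ext p <;> simp only [atomicType, Set.mem_ofPred_eq]
    · exact forall₂_congr fun a ha => by rw [h _ a ha, h _ a ha]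
    · refine exists_congr fun a => and_congr_right fun ha => exists_congr fun b =>
        and_congr_right fun hb => by rw [h _ a ha, h _ b hb]
    · refine exists_congr fun a => and_congr_right fun ha => by rw [h _ a ha]
  induction q generalizing n with
  | zero => exact h0 h
  | succ q ih =>
    exact setType_succ_eq (h0 h) (fun Y => ⟨Y, ih (snoc_agree h fun _ _ => Iff.rfl)⟩)
      (fun Y => ⟨Y, ih (snoc_agree h fun _ _ => Iff.rfl)⟩)

/-- Membership of a relation between elements of different blocks depends only on their colours. -/
def CrossDetermined (R : S → D → D → Prop) (μ : D → M) (β : D → I) : Prop :=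
  ∀ s a b a' b', β a ≠ β b → β a' ≠ β b' → μ a = μ a' → μ b = μ b' → R s a b → R s a' b'

/-- A related pair that meets both parts is transferred through its colours: the atomic types of the
parts record which colours occur in each set, and any two elements of these colours taken from the
two new parts are related again. -/
theorem atomicType_union {β : D → I} (hR : CrossDetermined R μ β) {n : ℕ} {P Q P' Q' : Set D}
    (hPQ : ∀ a ∈ P, ∀ b ∈ Q, β a ≠ β b) (hPQ' : ∀ a ∈ P', ∀ b ∈ Q', β a ≠ β b)
    {X X' : Fin n → Set D}
    (hP : atomicType R μ P X = atomicType R μ P' X')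
    (hQ : atomicType R μ Q X = atomicType R μ Q' X') :
    atomicType R μ (P ∪ Q) X = atomicType R μ (P' ∪ Q') X' := by
  simp only [atomicType, Prod.mk.injEq, Set.ext_iff, Set.mem_ofPred_eq] at hP hQ
  obtain ⟨p1, p2, p3⟩ := hP
  obtain ⟨q1, q2, q3⟩ := hQ
  refine Prod.ext ?_ (Prod.ext ?_ ?_)
  · ext p
    simp only [atomicType, Set.mem_ofPred_eq, Set.mem_union, or_imp, forall_and]
    rw [p1, q1]
  · have key {P Q P' Q' : Set D} {X X' : Fin n → Set D}
        (hPQ : ∀ a ∈ P, ∀ b ∈ Q, β a ≠ β b) (hPQ' : ∀ a ∈ P', ∀ b ∈ Q', β a ≠ β b)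
        (p2 : ∀ x : S × Fin n × Fin n, (∃ a ∈ P, ∃ b ∈ P, a ∈ X x.2.1 ∧ b ∈ X x.2.2 ∧ R x.1 a b) →
          (∃ a ∈ P', ∃ b ∈ P', a ∈ X' x.2.1 ∧ b ∈ X' x.2.2 ∧ R x.1 a b))
        (q2 : ∀ x : S × Fin n × Fin n, (∃ a ∈ Q, ∃ b ∈ Q, a ∈ X x.2.1 ∧ b ∈ X x.2.2 ∧ R x.1 a b) →
          (∃ a ∈ Q', ∃ b ∈ Q', a ∈ X' x.2.1 ∧ b ∈ X' x.2.2 ∧ R x.1 a b))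
        (p3 : ∀ x : M × Fin n, (∃ a ∈ P, a ∈ X x.2 ∧ μ a = x.1) →
          (∃ a ∈ P', a ∈ X' x.2 ∧ μ a = x.1))
        (q3 : ∀ x : M × Fin n, (∃ a ∈ Q, a ∈ X x.2 ∧ μ a = x.1) →
          (∃ a ∈ Q', a ∈ X' x.2 ∧ μ a = x.1))
        (s : S) (i j : Fin n)
        (h : ∃ a ∈ P ∪ Q, ∃ b ∈ P ∪ Q, a ∈ X i ∧ b ∈ X j ∧ R s a b) :
        ∃ a ∈ P' ∪ Q', ∃ b ∈ P' ∪ Q', a ∈ X' i ∧ b ∈ X' j ∧ R s a b := by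
      obtain ⟨a, ha, b, hb, hai, hbj, hs⟩ := h
      rcases ha with ha | ha <;> rcases hb with hb | hb
      · obtain ⟨a', ha', b', hb', h⟩ := p2 (s, i, j) ⟨a, ha, b, hb, hai, hbj, hs⟩
        exact ⟨a', Or.inl ha', b', Or.inl hb', h⟩
      · obtain ⟨a', ha', hai', ea⟩ := p3 (μ a, i) ⟨a, ha, hai, rfl⟩
        obtain ⟨b', hb', hbj', eb⟩ := q3 (μ b, j) ⟨b, hb, hbj, rfl⟩
        exact ⟨a', Or.inl ha', b', Or.inr hb', hai', hbj',
          hR s a b a' b' (hPQ a ha b hb) (hPQ' a' ha' b' hb') ea.symm eb.symm hs⟩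
      · obtain ⟨a', ha', hai', ea⟩ := q3 (μ a, i) ⟨a, ha, hai, rfl⟩
        obtain ⟨b', hb', hbj', eb⟩ := p3 (μ b, j) ⟨b, hb, hbj, rfl⟩
        exact ⟨a', Or.inr ha', b', Or.inl hb', hai', hbj',
          hR s a b a' b' (hPQ b hb a ha).symm (hPQ' b' hb' a' ha').symm ea.symm eb.symm hs⟩
      · obtain ⟨a', ha', b', hb', h⟩ := q2 (s, i, j) ⟨a, ha, b, hb, hai, hbj, hs⟩
        exact ⟨a', Or.inr ha', b', Or.inr hb', h⟩
    ext ⟨s, i, j⟩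
    exact ⟨key hPQ hPQ' (fun x => (p2 x).1) (fun x => (q2 x).1) (fun x => (p3 x).1)
        (fun x => (q3 x).1) s i j,
      key hPQ' hPQ (fun x => (p2 x).2) (fun x => (q2 x).2) (fun x => (p3 x).2)
        (fun x => (q3 x).2) s i j⟩
  · ext p
    simp only [atomicType, Set.mem_ofPred_eq, Set.mem_union, or_and_right, exists_or]
    rw [p3, q3]

/-- Composition: the type in a union of two separated parts is determined by the types in the
parts. -/
theorem setType_union {β : D → I} (hR : CrossDetermined R μ β) {q n : ℕ} {P Q P' Q' : Set D}
    (hPQ : ∀ a ∈ P, ∀ b ∈ Q, β a ≠ β b) (hPQ' : ∀ a ∈ P', ∀ b ∈ Q', β a ≠ β b)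
    {X X' : Fin n → Set D}
    (hP : setType R μ q P X = setType R μ q P' X')
    (hQ : setType R μ q Q X = setType R μ q Q' X') :
    setType R μ q (P ∪ Q) X = setType R μ q (P' ∪ Q') X' := by
  induction q generalizing n with
  | zero => exact atomicType_union hR hPQ hPQ' hP hQ
  | succ q ih =>
    -- The responses in the two disjoint parts are found independently and glued to one set.
    have merge {P Q : Set D} (hPQ : ∀ a ∈ P, ∀ b ∈ Q, β a ≠ β b) (X : Fin n → Set D)
        (Y₁ Y₂ : Set D) : ∃ Y,
        setType R μ q P (Fin.snoc X Y : Fin (n + 1) → Set D) =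
          setType R μ q P (Fin.snoc X Y₁ : Fin (n + 1) → Set D) ∧
        setType R μ q Q (Fin.snoc X Y : Fin (n + 1) → Set D) =
          setType R μ q Q (Fin.snoc X Y₂ : Fin (n + 1) → Set D) := by
      refine ⟨(Y₁ ∩ P) ∪ (Y₂ \ P), setType_congr (snoc_agree (fun _ _ _ => Iff.rfl) ?_),
        setType_congr (snoc_agree (fun _ _ _ => Iff.rfl) ?_)⟩
      · intro a ha
        simp [ha]
      · intro a ha
        have : a ∉ P := fun h => hPQ a h a ha rfl
        simp [this]
    refine setType_succ_eq (atomicType_union hR hPQ hPQ' (atomicType_eq_of_setType_eq hP)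
      (atomicType_eq_of_setType_eq hQ)) (fun Y => ?_) (fun Y => ?_)
    · obtain ⟨Y₁, h₁⟩ := exists_setType_snoc_eq hP Y
      obtain ⟨Y₂, h₂⟩ := exists_setType_snoc_eq hQ Y
      obtain ⟨Y', h₁', h₂'⟩ := merge hPQ' X' Y₁ Y₂
      exact ⟨Y', ih (h₁.trans h₁'.symm) (h₂.trans h₂'.symm)⟩
    · obtain ⟨Y₁, h₁⟩ := exists_setType_snoc_eq hP.symm Y
      obtain ⟨Y₂, h₂⟩ := exists_setType_snoc_eq hQ.symm Y
      obtain ⟨Y', h₁', h₂'⟩ := merge hPQ X Y₁ Y₂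
      exact ⟨Y', ih (h₁'.trans h₁.symm) (h₂'.trans h₂.symm)⟩

/-- Exchanging the contents of two blocks of equal type does not change the global type. -/
theorem setType_univ_exchange {β : D → I} (hR : CrossDetermined R μ β) {q n : ℕ} {b b' : I}
    {X X' : Fin n → Set D} (hX : ∀ i a, β a ≠ b → β a ≠ b' → (a ∈ X i ↔ a ∈ X' i))
    (h : setType R μ q (β ⁻¹' {b}) X = setType R μ q (β ⁻¹' {b'}) X')
    (h' : setType R μ q (β ⁻¹' {b'}) X = setType R μ q (β ⁻¹' {b}) X') :
    setType R μ q Set.univ X = setType R μ q Set.univ X' := by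
  by_cases hb : b = b'
  · subst hb
    have := setType_union hR (P := β ⁻¹' {b}) (Q := (β ⁻¹' {b})ᶜ) (P' := β ⁻¹' {b})
      (Q' := (β ⁻¹' {b})ᶜ) (by rintro a rfl c hc; exact fun h => hc h.symm)
      (by rintro a rfl c hc; exact fun h => hc h.symm) h
      (setType_congr fun i a ha => hX i a ha ha)
    simpa using this
  · have h2 := setType_union hR (P := β ⁻¹' {b}) (Q := β ⁻¹' {b'}) (P' := β ⁻¹' {b'})
      (Q' := β ⁻¹' {b}) (by rintro a rfl c rfl; exact hb)
      (by rintro a rfl c rfl; exact Ne.symm hb) h h'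
    -- The two blocks together form the same part before and after the exchange, so only the
    -- unchanged complement remains to be added.
    rw [Set.union_comm (β ⁻¹' {b'})] at h2
    have sep : ∀ a ∈ β ⁻¹' {b} ∪ β ⁻¹' {b'}, ∀ c ∈ (β ⁻¹' {b} ∪ β ⁻¹' {b'})ᶜ, β a ≠ β c := by
      intro a ha c hc hac
      simp only [Set.mem_union, Set.mem_preimage, Set.mem_singleton_iff, Set.mem_compl_iff] at ha hc
      rw [hac] at ha
      exact hc ha
    have := setType_union hR sep sep h2 (Q := (β ⁻¹' {b} ∪ β ⁻¹' {b'})ᶜ)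
      (setType_congr fun i a ha => by
        simp only [Set.mem_union, Set.mem_preimage, Set.mem_singleton_iff, Set.mem_compl_iff,
          not_or] at ha
        exact hX i a ha.1 ha.2)
    rwa [Set.union_compl_self] at this

end Types

/-! ### Formulae and types -/

/-- Quantifier rank. -/
def MSO.rank {L : FirstOrder.Language.{0, 0}} : {n : ℕ} → MSO L n → ℕ
  | _, .subset _ _ => 0
  | _, .rel _ _ => 0
  | _, .neg φ => φ.rank
  | _, .and φ ψ => max φ.rank ψ.rank
  | _, .ex φ => φ.rank + 1

/-- The relations of a structure as binary relations: a unary relation is read on the diagonal. -/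
def binRel (L : FirstOrder.Language.{0, 0}) (D : Type) [L.Structure D] (s : Σ n, L.Relations n)
    (a b : D) : Prop :=
  Structure.RelMap s.2 (fun i => if i.1 = 0 then a else b) ∧ (s.1 = 1 → a = b)

theorem MSO.sat_rel_iff {L : FirstOrder.Language.{0, 0}} {D : Type} [L.Structure D]
    {n k : ℕ} (hk : k = 1 ∨ k = 2) (r : L.Relations k) (z : Fin k → Fin n) :
    ∃ i j : Fin n, ∀ X : Fin n → Set D,
      (MSO.rel r z).Sat X ↔ ∃ a b, a ∈ X i ∧ b ∈ X j ∧ binRel L D ⟨k, r⟩ a b := by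
  rcases hk with rfl | rfl
  · refine ⟨z 0, z 0, fun X => ⟨?_, ?_⟩⟩
    · rintro ⟨a, ha, hr⟩
      refine ⟨a 0, a 0, ha 0, ha 0, ?_, fun _ => rfl⟩
      convert hr using 1
      ext i
      simp [Subsingleton.elim i 0]
    · rintro ⟨a, b, ha, hb, hr, -⟩
      refine ⟨_, fun i => ?_, hr⟩
      simpa [Subsingleton.elim i 0] using ha
  · refine ⟨z 0, z 1, fun X => ⟨?_, ?_⟩⟩
    · rintro ⟨a, ha, hr⟩
      refine ⟨a 0, a 1, ha 0, ha 1, ?_, fun h => absurd h (by norm_num)⟩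
      convert hr using 1
      ext i
      fin_cases i <;> rfl
    · rintro ⟨a, b, ha, hb, hr, -⟩
      refine ⟨_, fun i => ?_, hr⟩
      fin_cases i
      · simpa using ha
      · simpa using hb

/-- Types speak about binary relations only, which is enough because unary ones are read on the
diagonal. Allowing any `q` above the rank lets two formulae share one notion of type. -/
theorem MSO.sat_iff_of_setType_eq {L : FirstOrder.Language.{0, 0}} {D M : Type} [L.Structure D]
    (hL : ∀ k, L.Relations k → k = 1 ∨ k = 2) (μ : D → M) {n : ℕ} (φ : MSO L n) {q : ℕ}
    (hq : φ.rank ≤ q) {X X' : Fin n → Set D}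
    (h : setType (binRel L D) μ q Set.univ X = setType (binRel L D) μ q Set.univ X') :
    φ.Sat X ↔ φ.Sat X' := by
  induction φ generalizing q with
  | subset i j =>
    have h := congrArg Prod.fst (atomicType_eq_of_setType_eq h)
    have := Set.ext_iff.1 h (i, j)
    simpa [atomicType, MSO.Sat, Set.subset_def] using this
  | rel r z =>
    obtain ⟨i, j, hij⟩ := MSO.sat_rel_iff (D := D) (hL _ r) r z
    rw [hij, hij]
    have h := congrArg (fun p => p.2.1) (atomicType_eq_of_setType_eq h)
    have := Set.ext_iff.1 h (⟨_, r⟩, i, j)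
    simpa [atomicType] using this
  | neg φ ih => exact not_congr (ih hq h)
  | and φ ψ ih₁ ih₂ =>
    exact and_congr (ih₁ (le_trans (le_max_left _ _) hq) h) (ih₂ (le_trans (le_max_right _ _) hq) h)
  | ex φ ih =>
    obtain ⟨q, rfl⟩ : ∃ p, q = p + 1 := ⟨q - 1, by simp only [MSO.rank] at hq; omega⟩
    have hq : φ.rank ≤ q := by simp only [MSO.rank] at hq; omega
    constructor
    · rintro ⟨Y, hY⟩
      obtain ⟨Y', h'⟩ := exists_setType_snoc_eq h Y
      exact ⟨Y', (ih hq h').1 hY⟩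
    · rintro ⟨Y, hY⟩
      obtain ⟨Y', h'⟩ := exists_setType_snoc_eq h.symm Y
      exact ⟨Y', (ih hq h').1 hY⟩

/-! ### Shallow digraphs -/

section Shallow
variable {D : Type} {E : D → D → Prop} {c : ℕ}

/-- `W` can be exhausted in `n` rounds, where each round deletes at most `c` elements and then splits
the remaining set into parts without edges between them. -/
def Shallow (E : D → D → Prop) (c : ℕ) : ℕ → Set D → Prop
  | 0, W => W = ∅
  | n + 1, W => ∃ Z : Set D, Z.ncard ≤ c ∧ ∃ (I : Type) (β : D → I),
      (∀ x ∈ W \ Z, ∀ y ∈ W \ Z, E x y → β x = β y) ∧ ∀ i, Shallow E c n ((W \ Z) ∩ β ⁻¹' {i})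

theorem Shallow.mono {n : ℕ} {W W' : Set D} (h : Shallow E c n W) (hW : W' ⊆ W) :
    Shallow E c n W' := by
  induction n generalizing W W' with
  | zero =>
    have h : W = ∅ := h
    exact Set.subset_empty_iff.1 (h ▸ hW)
  | succ n ih =>
    obtain ⟨Z, hZ, I, β, hβ, hi⟩ := h
    have hs : W' \ Z ⊆ W \ Z := Set.sdiff_subset_sdiff_left hW
    exact ⟨Z, hZ, I, β, fun x hx y hy => hβ x (hs hx) y (hs hy),
      fun i => ih (hi i) (Set.inter_subset_inter_left _ hs)⟩

theorem shallow_empty (n : ℕ) : Shallow E c n ∅ := by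
  induction n with
  | zero => rfl
  | succ n ih =>
    exact ⟨∅, by simp, Unit, fun _ => (), fun _ _ _ _ _ => rfl, fun _ => by simpa using ih⟩

/-- If every target has a unique source and the cross edges are invariant under exchanging sources of
equal type, then every type contains at most two sources of cross edges. -/
theorem ncard_cross_sources_le [Finite D] {I T : Type} [Finite T] {β : D → I} {t : D → T}
    {G : Set D} (huniq : ∀ x ∈ G, ∀ x' ∈ G, ∀ y ∈ G, E x y → E x' y → x = x')
    (hexch : ∀ x ∈ G, ∀ x' ∈ G, ∀ y ∈ G, β x ≠ β y → β x' ≠ β y → t x = t x' → E x y → E x' y) :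
    {x ∈ G | ∃ y ∈ G, β x ≠ β y ∧ E x y}.ncard ≤ 2 * Nat.card T := by
  classical
  have := Fintype.ofFinite D
  have := Fintype.ofFinite T
  rw [Set.ncard_eq_toFinset_card', Nat.card_eq_fintype_card]
  refine Finset.card_le_mul_card_image_of_maps_to (f := t) (t := Finset.univ)
    (fun _ _ => Finset.mem_univ _) 2 fun τ _ => ?_
  by_contra! h
  obtain ⟨a, b, d, ha, hb, hd, hab, had, hbd⟩ := Finset.two_lt_card_iff.1 h
  simp only [Finset.mem_filter, Set.mem_toFinset] at ha hb hd
  obtain ⟨⟨haG, ya, hya, hna, hea⟩, rfl⟩ := ha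
  obtain ⟨⟨hbG, yb, hyb, hnb, heb⟩, hbt⟩ := hb
  obtain ⟨⟨hdG, -⟩, hdt⟩ := hd
  -- If `x'` were outside the block of the target `y`, the exchange would make it a second
  -- predecessor of `y`. So all other elements of the type of `x` lie in the block of `y`. With
  -- three sources `a`, `b`, `d`, this puts `b` and `d` into the block of `ya` and `d` into that of
  -- `yb`; hence `b` and `yb` share a block.
  have key : ∀ x ∈ G, ∀ x' ∈ G, ∀ y ∈ G, β x ≠ β y → t x = t x' → E x y → x ≠ x' →
      β x' = β y := by
    intro x hx x' hx' y hy hxy ht hE hne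
    by_contra hβ
    exact hne (huniq x hx x' hx' y hy hE (hexch x hx x' hx' y hy hxy hβ ht hE))
  have h1 := key a haG b hbG ya hya hna hbt.symm hea hab
  have h2 := key a haG d hdG ya hya hna hdt.symm hea had
  have h3 := key b hbG d hdG yb hyb hnb (hbt.trans hdt.symm) heb hbd
  exact hnb (h1.trans (h2.symm.trans h3))

end Shallow

/-! ### Incidence structures of complete trees -/

section Trees
variable {m n : ℕ}

/-- The vertex `w` in the incidence structure of a complete tree. -/
def treeVertex (w : List (Fin m)) (h : w.length < n) : (incidence (completeTree m n)).Dom :=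
  Sum.inl ⟨w, h⟩

/-- The edge from `w` to `wd` as a tuple of the complete tree. -/
def edgeTuple (w : List (Fin m)) (d : Fin m) (h : (w ++ [d]).length < n) :
    Tuples (completeTree m n) :=
  ⟨⟨2, ![(⟨w, by simp only [List.length_append, List.length_singleton] at h; omega⟩ :
      {w : List (Fin m) // w.length < n}), ⟨w ++ [d], h⟩]⟩, .adj, by exact ⟨d, rfl⟩⟩

/-- The edge from `w` to `wd` in the incidence structure of a complete tree. -/
def treeEdge (w : List (Fin m)) (d : Fin m) (h : (w ++ [d]).length < n) :
    (incidence (completeTree m n)).Dom :=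
  Sum.inr (edgeTuple w d h)

theorem exists_eq_edgeTuple (e : Tuples (completeTree m n)) : ∃ w d h, e = edgeTuple w d h := by
  obtain ⟨⟨k, c⟩, R, hR⟩ := e
  cases R
  obtain ⟨d, hd⟩ := hR
  refine ⟨(c 0).1, d, hd ▸ (c 1).2, ?_⟩
  refine Subtype.ext (Sigma.ext rfl (heq_of_eq (funext fun i => ?_)))
  fin_cases i
  · rfl
  · exact Subtype.ext hd

/-- The word of a vertex, and the word of the target of an edge. -/
def treeWord : (incidence (completeTree m n)).Dom → List (Fin m)
  | .inl w => w.1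
  | .inr e => if h : 1 < e.1.1 then (e.1.2 ⟨1, h⟩).1 else []

@[simp] theorem treeWord_treeVertex (w : List (Fin m)) (h : w.length < n) :
    treeWord (treeVertex w h) = w := rfl

@[simp] theorem treeWord_treeEdge (w : List (Fin m)) (d : Fin m) (h : (w ++ [d]).length < n) :
    treeWord (treeEdge w d h) = w ++ [d] := rfl

theorem treeVertex_or_treeEdge (x : (incidence (completeTree m n)).Dom) :
    (∃ w h, x = treeVertex w h) ∨ ∃ w d h, x = treeEdge w d h := by
  rcases x with ⟨w, h⟩ | e
  · exact Or.inl ⟨w, h, rfl⟩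
  · obtain ⟨w, d, h, rfl⟩ := exists_eq_edgeTuple e
    exact Or.inr ⟨w, d, h, rfl⟩

theorem treeVertex_ne_treeEdge {w v : List (Fin m)} {d : Fin m} {h : w.length < n}
    {h' : (v ++ [d]).length < n} : treeVertex w h ≠ treeEdge v d h' := Sum.inl_ne_inr

theorem treeWord_length_lt (x : (incidence (completeTree m n)).Dom) :
    (treeWord x).length < n := by
  rcases treeVertex_or_treeEdge x with ⟨w, h, rfl⟩ | ⟨w, d, h, rfl⟩ <;> exact h

/-- An edge of a tree is determined by its target, so each word belongs to at most one vertex and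
one edge. -/
theorem treeWord_isLeft_injective : Function.Injective
    fun x : (incidence (completeTree m n)).Dom => (treeWord x, Sum.isLeft x) := by
  intro x y hxy
  rcases treeVertex_or_treeEdge x with ⟨w, h, rfl⟩ | ⟨w, d, h, rfl⟩ <;>
    rcases treeVertex_or_treeEdge y with ⟨w', h', rfl⟩ | ⟨w', d', h', rfl⟩
  · have : w = w' := congrArg Prod.fst hxy
    subst this; rfl
  · exact absurd (congrArg Prod.snd hxy) Bool.true_eq_false.mp
  · exact absurd (congrArg Prod.snd hxy).symm Bool.true_eq_false.mp
  · have : w ++ [d] = w' ++ [d'] := congrArg Prod.fst hxy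
    obtain ⟨rfl, h⟩ := List.append_inj' this rfl
    obtain rfl : d = d' := by simpa using h
    rfl

/-- The successor relation of the subdivided tree. -/
def TreeSucc (x y : (incidence (completeTree m n)).Dom) : Prop :=
  (∃ w d h h', x = treeVertex w h ∧ y = treeEdge w d h') ∨
    ∃ w d h, x = treeEdge w d h ∧ y = treeVertex (w ++ [d]) h

/-- The symbol `in_i` of the incidence language of graphs. -/
def graphInc (i : ℕ) (hi : i < 2) : (incLang FirstOrder.Language.graph).Relations 2 :=
  IncRel.inc i ⟨2, hi, ⟨.adj⟩⟩

theorem relMap_inc_iff {i : ℕ} {h} (x : Fin 2 → (incidence (completeTree m n)).Dom) :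
    Structure.RelMap (L := incLang FirstOrder.Language.graph) (IncRel.inc i h) x ↔
      ∃ w d h h', x 1 = treeEdge w d h ∧
        (i = 0 ∧ x 0 = treeVertex w h' ∨ i = 1 ∧ x 0 = treeVertex (w ++ [d]) h) := by
  constructor
  · rintro ⟨e, hi, h0, h1⟩
    obtain ⟨w, d, h, rfl⟩ := exists_eq_edgeTuple e
    refine ⟨w, d, h, by simp only [List.length_append, List.length_singleton] at h; omega, h1, ?_⟩
    have hi' : i < 2 := hi
    interval_cases i
    · exact Or.inl ⟨rfl, h0⟩
    · exact Or.inr ⟨rfl, h0⟩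
  · rintro ⟨w, d, hw, h', h1, ⟨rfl, h0⟩ | ⟨rfl, h0⟩⟩
    · exact ⟨edgeTuple w d hw, Nat.zero_lt_two, h0, h1⟩
    · exact ⟨edgeTuple w d hw, Nat.one_lt_two, h0, h1⟩

/-- Both incidence relations list the vertex before the edge. Orienting paths away from the root
therefore reverses the arguments of `in_1`, and `FormulaSucc` has the same shape. -/
theorem treeSucc_iff (x y : (incidence (completeTree m n)).Dom) :
    TreeSucc x y ↔ Structure.RelMap (graphInc 0 (by norm_num)) ![x, y] ∨
      Structure.RelMap (graphInc 1 (by norm_num)) ![y, x] := by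
  unfold graphInc
  rw [relMap_inc_iff, relMap_inc_iff]
  constructor
  · rintro (⟨w, d, h, h', rfl, rfl⟩ | ⟨w, d, h, rfl, rfl⟩)
    · exact Or.inl ⟨w, d, h', h, rfl, Or.inl ⟨rfl, rfl⟩⟩
    · exact Or.inr ⟨w, d, h, by simp only [List.length_append, List.length_singleton] at h; omega,
        rfl, Or.inr ⟨rfl, rfl⟩⟩
  · rintro (⟨w, d, h, h', h1, ⟨-, h0⟩ | ⟨h0, -⟩⟩ | ⟨w, d, h, h', h1, ⟨h0, -⟩ | ⟨-, h0⟩⟩)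
    · exact Or.inl ⟨w, d, h', h, h0, h1⟩
    · omega
    · omega
    · exact Or.inr ⟨w, d, h, h1, h0⟩

/-- This is why the oriented relation is used instead of plain incidence: uniqueness of predecessors
bounds the number of sources of cross edges. -/
theorem TreeSucc.unique {x x' y : (incidence (completeTree m n)).Dom} (h : TreeSucc x y)
    (h' : TreeSucc x' y) : x = x' := by
  rcases h with ⟨w, d, h1, h2, rfl, rfl⟩ | ⟨w, d, h1, rfl, rfl⟩ <;>
    rcases h' with ⟨w', d', h1', h2', rfl, e⟩ | ⟨w', d', h1', rfl, e⟩
  · have := congrArg treeWord e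
    obtain ⟨rfl, -⟩ := List.append_inj' (this : w ++ [d] = w' ++ [d']) rfl
    rfl
  · exact absurd e.symm treeVertex_ne_treeEdge
  · exact absurd e treeVertex_ne_treeEdge
  · have := congrArg treeWord e
    obtain ⟨rfl, h⟩ := List.append_inj' (this : w ++ [d] = w' ++ [d']) rfl
    obtain rfl : d = d' := by simpa using h
    rfl

/-- Climbing from any element to `v` passes through vertices and edges whose words still extend `v`.
The edge leading into `v` also belongs to this connected set. -/
theorem subtree_constant {I : Type} {β : (incidence (completeTree m n)).Dom → I}
    {v : List (Fin m)} (hv : v.length < n)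
    (hβ : ∀ x y, v <+: treeWord x → v <+: treeWord y → TreeSucc x y → β x = β y)
    (x : (incidence (completeTree m n)).Dom) (hx : v <+: treeWord x) :
    β x = β (treeVertex v hv) := by
  have hvert (w : List (Fin m)) (hw : w.length < n) (hvw : v <+: w) :
      β (treeVertex w hw) = β (treeVertex v hv) := by
    induction w using List.reverseRecOn with
    | nil =>
      obtain rfl := List.prefix_nil.1 hvw
      rfl
    | append_singleton w d ih =>
      rcases List.prefix_concat_iff.1 hvw with rfl | h
      · rfl
      · have hw' : w.length < n := by
          simp only [List.length_append, List.length_singleton] at hw; omega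
        rw [← ih hw' h, ← hβ (treeEdge w d hw) (treeVertex _ hw) hvw hvw (Or.inr ⟨w, d, hw, rfl, rfl⟩)]
        exact (hβ (treeVertex w hw') (treeEdge w d hw) h hvw (Or.inl ⟨w, d, hw', hw, rfl, rfl⟩)).symm
  rcases treeVertex_or_treeEdge x with ⟨w, h, rfl⟩ | ⟨w, d, h, rfl⟩
  · exact hvert w h hx
  · rw [← hvert _ h hx]
    exact hβ _ _ hx hx (Or.inr ⟨w, d, h, rfl, rfl⟩)

/-- A subdivided complete tree of large degree and height `n + 1` is not shallow for `n` rounds. -/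
theorem not_shallow_of_tree {D : Type} [Finite D] {E : D → D → Prop} {c N : ℕ} (hc : c < N)
    {f : (incidence (completeTree N (n + 1))).Dom → D} (hf : Function.Injective f)
    (hE : ∀ x y, TreeSucc x y → E (f x) (f y)) (j : ℕ) (u : List (Fin N))
    (hu : u.length + j = n) {W : Set D} (hW : ∀ x, u <+: treeWord x → f x ∈ W) :
    ¬ Shallow E c j W := by
  induction j generalizing u W with
  | zero =>
    intro h
    have h : W = ∅ := h
    -- Here `u` has length `n`, which height `n + 1` still admits, so a vertex is left over.
    have := hW (treeVertex u (by omega)) (List.prefix_refl u)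
    rw [h] at this
    exact this
  | succ j ih =>
    rintro ⟨Z, hZ, I, β, hβ, hi⟩
    -- The subtrees of the `N` children, each with its incoming edge, are disjoint. If `Z` met all
    -- of them, it would have at least `N > c` elements.
    obtain ⟨d, hd⟩ : ∃ d : Fin N, ∀ x, u ++ [d] <+: treeWord x → f x ∉ Z := by
      by_contra! h
      choose x hx hxZ using h
      have hinj : Function.Injective fun d => f (x d) := by
        intro d d' hdd
        have h1 := hx d
        rw [hf hdd] at h1
        have h2 := (List.prefix_of_prefix_length_le h1 (hx d') (by simp)).eq_of_length (by simp)
        simpa using h2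
      have : N ≤ Z.ncard := by
        calc N = (Set.range fun d => f (x d)).ncard := by
              rw [← Set.image_univ, Set.ncard_image_of_injective _ hinj, Set.ncard_univ]
              simp
          _ ≤ Z.ncard := Set.ncard_le_ncard (by rintro _ ⟨d, rfl⟩; exact hxZ d) Z.toFinite
      omega
    have hmem : ∀ x, u ++ [d] <+: treeWord x → f x ∈ W \ Z := fun x hx =>
      ⟨hW x ((List.prefix_append u [d]).trans hx), hd x hx⟩
    have hv : (u ++ [d]).length < n + 1 := by simp; omega
    refine ih (u ++ [d]) (by simp; omega) (fun x hx => Set.mem_inter (hmem x hx) ?_)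
      (hi (β (f (treeVertex (u ++ [d]) hv))))
    exact subtree_constant (β := fun x => β (f x)) hv
      (fun x y hx hy hxy => hβ _ (hmem x hx) _ (hmem y hy) (hE x y hxy)) x hx

/-- The block of a word relative to `u`: the direction in which `w` extends `u`, if it does. -/
def wordBlock (u w : List (Fin m)) : Option (Fin m) :=
  if u <+: w then w[u.length]? else none

/-- An edge carries the word of its target, so a step from a vertex to an outgoing edge changes the
block only at `u` itself, and a step from an edge to its target never does. -/
theorem wordBlock_concat {u w : List (Fin m)} (h : w ≠ u) (d : Fin m) :
    wordBlock u (w ++ [d]) = wordBlock u w := by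
  unfold wordBlock
  by_cases h1 : u <+: w
  · have h2 : u <+: w ++ [d] := h1.trans (List.prefix_append _ _)
    have h3 : u.length < w.length := lt_of_le_of_ne h1.length_le
      fun h' => h (h1.eq_of_length h').symm
    rw [if_pos h1, if_pos h2, List.getElem?_append_left h3]
  · rw [if_neg h1]
    split_ifs with h2
    · rcases List.prefix_concat_iff.1 h2 with rfl | h3
      · simp
      · exact absurd h3 h1
    · rfl

theorem prefix_of_wordBlock_eq_some {u w : List (Fin m)} {d : Fin m}
    (h : wordBlock u w = some d) : u ++ [d] <+: w := by
  unfold wordBlock at h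
  split_ifs at h with h1
  obtain ⟨l, rfl⟩ := h1
  cases l with
  | nil => simp at h
  | cons a l =>
    obtain rfl : a = d := by simpa using h
    exact ⟨l, by simp⟩

theorem eq_of_wordBlock_eq_none {u w : List (Fin m)} (hu : u <+: w)
    (h : wordBlock u w = none) : w = u := by
  unfold wordBlock at h
  rw [if_pos hu] at h
  exact (hu.eq_of_length (le_antisymm hu.length_le (by simpa using h))).symm

/-- A digraph on `k` copies of a subdivided tree of height `n` is shallow for `n` rounds if the
edges between different blocks can be covered by few elements. -/
theorem shallow_of_cover {k c : ℕ} {E : (incidence (completeTree m n)).Dom × Fin k →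
      (incidence (completeTree m n)).Dom × Fin k → Prop}
    {G : Set ((incidence (completeTree m n)).Dom × Fin k)}
    (hcover : ∀ u : List (Fin m), ∃ Z : Set ((incidence (completeTree m n)).Dom × Fin k),
      Z.ncard ≤ c ∧ ∀ x ∈ G, ∀ y ∈ G, x ∉ Z → E x y →
        wordBlock u (treeWord x.1) = wordBlock u (treeWord y.1))
    (j : ℕ) (u : List (Fin m)) (hu : u.length + j = n) :
    Shallow E (c + 2 * k) j ({a | u <+: treeWord a.1} ∩ G) := by
  induction j generalizing u with
  | zero =>
    -- Now `u` has length `n`, while all words in a tree of height `n` are shorter.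
    refine Set.eq_empty_of_forall_notMem fun a ha => ?_
    have h1 := ha.1.length_le
    have h2 := treeWord_length_lt a.1
    omega
  | succ j ih =>
    obtain ⟨Z, hZ, hcov⟩ := hcover u
    -- Each of the `k` copies contains at most the vertex `u` and the edge into `u`. Once they are
    -- deleted, the block `none` contains nothing of the subtree at `u`.
    have hF : {a : (incidence (completeTree m n)).Dom × Fin k | treeWord a.1 = u}.ncard ≤
        2 * k := by
      calc _ ≤ (Set.univ : Set (Bool × Fin k)).ncard := by
            refine Set.ncard_le_ncard_of_injOn (fun a => (Sum.isLeft a.1, a.2))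
              (fun _ _ => Set.mem_univ _) ?_ (Set.toFinite _)
            intro a ha b hb hab
            exact Prod.ext (treeWord_isLeft_injective
              (Prod.ext (ha.trans hb.symm) (Prod.mk.inj hab).1)) (Prod.mk.inj hab).2
        _ = 2 * k := by simp [Set.ncard_univ]
    refine ⟨Z ∪ {a | treeWord a.1 = u}, (Set.ncard_union_le _ _).trans (add_le_add hZ hF), _,
      fun a => wordBlock u (treeWord a.1),
      fun x hx y hy hE => hcov x hx.1.2 y hy.1.2 (fun h => hx.2 (Or.inl h)) hE, fun i => ?_⟩
    cases i with
    | none =>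
      refine (shallow_empty j).mono ?_
      rintro a ⟨⟨⟨ha, -⟩, hn⟩, hi⟩
      exact hn (Or.inr (eq_of_wordBlock_eq_none ha hi))
    | some d =>
      refine (ih (u ++ [d]) (by simp; omega)).mono ?_
      rintro a ⟨⟨⟨ha, hG⟩, hn⟩, hi⟩
      exact ⟨prefix_of_wordBlock_eq_some hi, hG⟩

end Trees

/-! ### Transductions of complete trees -/

/-- The signature of `k` copies of an expanded incidence structure of a graph. -/
abbrev inputLang (l k : ℕ) : FirstOrder.Language.{0, 0} :=
  ((incLang FirstOrder.Language.graph).sum (paramLang l)).sum (copyLang k)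

theorem inputLang_arity {l k : ℕ} (j : ℕ) (r : (inputLang l k).Relations j) : j = 1 ∨ j = 2 := by
  rcases r with (r | r) | r <;> cases r <;> simp

/-- Needed for the finiteness of the types of elements, which are counted by `Nat.card`. -/
instance inputLang.finite_relations (l k : ℕ) : Finite (Σ j, (inputLang l k).Relations j) := by
  have h1 : Finite (Σ j, IncRel FirstOrder.Language.graph j) :=
    Finite.of_injective
      (Sum.inr : (Σ j, (incLang FirstOrder.Language.graph).Relations j) → Symbols _)
      Sum.inr_injective
  have h2 : Finite (Σ j, ParamRel l j) :=
    Finite.of_surjective (fun i : Fin l => ⟨1, .pred i⟩) fun ⟨_, .pred i⟩ => ⟨i, rfl⟩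
  have h3 : Finite (Σ j, CopyRel k j) := by
    by_cases hk : 2 ≤ k
    · refine Finite.of_surjective (fun i : Option (Fin k) =>
        (i.elim ⟨2, .same hk⟩ fun i => ⟨1, .part hk i⟩ : Σ j, CopyRel k j)) ?_
      rintro ⟨_, _ | ⟨_, i⟩⟩
      · exact ⟨none, rfl⟩
      · exact ⟨some i, rfl⟩
    · have : IsEmpty (Σ j, CopyRel k j) := ⟨by rintro ⟨_, h | ⟨h, _⟩⟩ <;> exact hk h⟩
      infer_instance
  refine Finite.of_surjective
    (fun s : ((Σ j, IncRel FirstOrder.Language.graph j) ⊕ (Σ j, ParamRel l j)) ⊕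
      (Σ j, CopyRel k j) => (Sum.elim (Sum.elim (fun s => ⟨s.1, Sum.inl (Sum.inl s.2)⟩)
        (fun s => ⟨s.1, Sum.inl (Sum.inr s.2)⟩)) (fun s => ⟨s.1, Sum.inr s.2⟩) s :
        Σ j, (inputLang l k).Relations j)) ?_
  rintro ⟨j, (r | r) | r⟩
  · exact ⟨Sum.inl (Sum.inl ⟨j, r⟩), rfl⟩
  · exact ⟨Sum.inl (Sum.inr ⟨j, r⟩), rfl⟩
  · exact ⟨Sum.inr ⟨j, r⟩, rfl⟩

section Input
variable {m n k l : ℕ}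

/-- The block of an element of the input structure relative to the vertex `u`. -/
def inputBlock (u : List (Fin m)) (a : (incidence (completeTree m n)).Dom × Fin k) :
    Option (Fin m) :=
  wordBlock u (treeWord a.1)

/-- The colour of an element relative to `u`: the number of its copy, and whether it is a copy of
the vertex `u` or of an edge leaving `u`. -/
def inputColour (u : List (Fin m)) (a : (incidence (completeTree m n)).Dom × Fin k) :
    Fin k × Prop × Prop :=
  (a.2, (∃ h, a.1 = treeVertex u h), ∃ d h, a.1 = treeEdge u d h)

/-- Unary relations, `in_1` and the copy relation `∼` never join different blocks. Only `in_0` does,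
between `u` and the edges leaving `u` within one copy, and the colours record exactly this. -/
theorem crossDetermined_input (Q : Fin l → Set (incidence (completeTree m n)).Dom)
    (u : List (Fin m)) :
    CrossDetermined (binRel (inputLang l k) (copy k (expand (incidence (completeTree m n)) Q)).Dom)
      (inputColour u) (inputBlock u) := by
  rintro ⟨j, r⟩ a b a' b' hab hab' ha hb ⟨hr, h1⟩
  rcases inputLang_arity j r with rfl | rfl
  · exact absurd (congrArg _ (h1 rfl)) hab
  refine ⟨?_, fun h => absurd h (by norm_num)⟩
  rcases r with (r | r) | r
  · cases r with
    | inc i hi =>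
      obtain ⟨p, x, hx, hxe⟩ := hr
      have hx0 : a = (x 0, p) := congrFun hxe 0
      have hx1 : b = (x 1, p) := congrFun hxe 1
      subst hx0 hx1
      have hx' : Structure.RelMap (L := incLang FirstOrder.Language.graph)
        (M := (incidence (completeTree m n)).Dom) (IncRel.inc i hi) x := hx
      obtain ⟨w, d, h, h', e1, ⟨rfl, e0⟩ | ⟨rfl, e0⟩⟩ := (relMap_inc_iff x).1 hx'
      · obtain rfl : w = u := by
          by_contra hw
          refine hab ?_
          simp only [inputBlock, e0, e1, treeWord_treeVertex, treeWord_treeEdge]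
          exact (wordBlock_concat hw d).symm
        simp only [inputColour, Prod.mk.injEq] at ha hb
        obtain ⟨g', f0⟩ := ha.2.1.mp ⟨h', e0⟩
        obtain ⟨d', g, f1⟩ := hb.2.2.mp ⟨d, h, e1⟩
        have hr' : Structure.RelMap (L := incLang FirstOrder.Language.graph)
            (M := (incidence (completeTree m n)).Dom) (IncRel.inc 0 hi) ![a'.1, b'.1] :=
          (relMap_inc_iff _).2 ⟨w, d', g, g', f1, Or.inl ⟨rfl, f0⟩⟩
        refine ⟨p, ![a'.1, b'.1], hr', ?_⟩
        funext i
        fin_cases i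
        · exact Prod.ext rfl ha.1.symm
        · exact Prod.ext rfl hb.1.symm
      · refine absurd ?_ hab
        simp only [inputBlock, e0, e1, treeWord_treeVertex, treeWord_treeEdge]
  · cases r
  · cases r with
    | same h =>
      have : a.1 = b.1 := hr
      exact absurd (congrArg (fun x => wordBlock u (treeWord x)) this) hab

/-- Types of elements, regarded as singletons in one of the two places of a pair of sets. -/
abbrev ElementType (S M : Type) (q : ℕ) : Type :=
  SetType S M q 2 × SetType S M q 2 × SetType S M q 2

/-- The type of an element inside of its block. -/
def elementType {D S M I : Type} (R : S → D → D → Prop) (μ : D → M) (β : D → I) (q : ℕ) (x : D) :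
    ElementType S M q :=
  (setType R μ q (β ⁻¹' {β x}) ![{x}, ∅], setType R μ q (β ⁻¹' {β x}) ![∅, {x}],
    setType R μ q (β ⁻¹' {β x}) ![∅, ∅])

theorem setType_univ_eq_of_elementType_eq {D S M I : Type} {R : S → D → D → Prop} {μ : D → M}
    {β : D → I} (hR : CrossDetermined R μ β) {q : ℕ} {x x' y : D} (hxy : β x ≠ β y)
    (hxy' : β x' ≠ β y) (ht : elementType R μ β q x = elementType R μ β q x') :
    setType R μ q Set.univ (fun i => {![x, y] i}) =
        setType R μ q Set.univ (fun i => {![x', y] i}) ∧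
      setType R μ q Set.univ (fun i => {![y, x] i}) =
        setType R μ q Set.univ (fun i => {![y, x'] i}) := by
  simp only [elementType, Prod.mk.injEq] at ht
  obtain ⟨t1, t2, t3⟩ := ht
  have hx {a z : D} {b : I} (hb : b ≠ β z) (ha : a ∈ β ⁻¹' {b}) : a ≠ z := by
    rintro rfl
    exact hb (Eq.symm ha)
  have own₁ {z : D} (hz : β z ≠ β y) : setType R μ q (β ⁻¹' {β z}) (fun i => {![z, y] i}) =
      setType R μ q (β ⁻¹' {β z}) ![{z}, ∅] := by
    refine setType_congr fun i a ha => ?_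
    fin_cases i
    · exact Iff.rfl
    · exact iff_of_false (hx hz ha) (Set.notMem_empty a)
  have own₂ {z : D} (hz : β z ≠ β y) : setType R μ q (β ⁻¹' {β z}) (fun i => {![y, z] i}) =
      setType R μ q (β ⁻¹' {β z}) ![∅, {z}] := by
    refine setType_congr fun i a ha => ?_
    fin_cases i
    · exact iff_of_false (hx hz ha) (Set.notMem_empty a)
    · exact Iff.rfl
  have other₁ {z : D} {b : I} (hz : b ≠ β z) (hb : b ≠ β y) :
      setType R μ q (β ⁻¹' {b}) (fun i => {![z, y] i}) =
        setType R μ q (β ⁻¹' {b}) ![∅, ∅] := by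
    refine setType_congr fun i a ha => ?_
    fin_cases i
    · exact iff_of_false (hx hz ha) (Set.notMem_empty a)
    · exact iff_of_false (hx hb ha) (Set.notMem_empty a)
  have other₂ {z : D} {b : I} (hz : b ≠ β z) (hb : b ≠ β y) :
      setType R μ q (β ⁻¹' {b}) (fun i => {![y, z] i}) =
        setType R μ q (β ⁻¹' {b}) ![∅, ∅] := by
    refine setType_congr fun i a ha => ?_
    fin_cases i
    · exact iff_of_false (hx hb ha) (Set.notMem_empty a)
    · exact iff_of_false (hx hz ha) (Set.notMem_empty a)
  have off₁ (i : Fin 2) (a : D) (h : β a ≠ β x) (h' : β a ≠ β x') :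
      a ∈ ({![x, y] i} : Set D) ↔ a ∈ ({![x', y] i} : Set D) := by
    fin_cases i
    · exact iff_of_false (fun e => h (congrArg β e)) (fun e => h' (congrArg β e))
    · exact Iff.rfl
  have off₂ (i : Fin 2) (a : D) (h : β a ≠ β x) (h' : β a ≠ β x') :
      a ∈ ({![y, x] i} : Set D) ↔ a ∈ ({![y, x'] i} : Set D) := by
    fin_cases i
    · exact Iff.rfl
    · exact iff_of_false (fun e => h (congrArg β e)) (fun e => h' (congrArg β e))
  have own₁' := (own₁ hxy).trans (t1.trans (own₁ hxy').symm)
  have own₂' := (own₂ hxy).trans (t2.trans (own₂ hxy').symm)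
  -- In a common block only the trace on that block changes. Otherwise each of the two blocks loses
  -- or gains its marked element, and the third component of `elementType`, the type without marked
  -- elements, compares the unmarked ones. The block of `y` is not involved.
  by_cases hb : β x = β x'
  · refine ⟨setType_univ_exchange hR off₁ own₁' ?_, setType_univ_exchange hR off₂ own₂' ?_⟩
    · rw [hb] at own₁' ⊢
      exact own₁'
    · rw [hb] at own₂' ⊢
      exact own₂'
  · exact ⟨setType_univ_exchange hR off₁ own₁'
        ((other₁ (Ne.symm hb) hxy').trans (t3.symm.trans (other₁ hb hxy).symm)),
      setType_univ_exchange hR off₂ own₂'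
        ((other₂ (Ne.symm hb) hxy').trans (t3.symm.trans (other₂ hb hxy).symm))⟩

/-- The successor relation of a graph that is given by formulae for its incidence structure. -/
def FormulaSucc {L : FirstOrder.Language.{0, 0}} {D : Type} [L.Structure D] (φ ψ : MSO L 2)
    (x y : D) : Prop :=
  φ.Holds ![x, y] ∨ ψ.Holds ![y, x]

/-- The number of deletions per round depends on `k`, `l` and the ranks, but neither on the degree
`m` nor on the parameters `Q`. -/
theorem shallow_formulaSucc (φ ψ : MSO (inputLang l k) 2)
    (Q : Fin l → Set (incidence (completeTree m n)).Dom)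
    (G : Set (copy k (expand (incidence (completeTree m n)) Q)).Dom)
    (huniq : ∀ x ∈ G, ∀ x' ∈ G, ∀ y ∈ G, FormulaSucc φ ψ x y → FormulaSucc φ ψ x' y → x = x') :
    Shallow (FormulaSucc φ ψ) (2 * Nat.card (ElementType (Σ j, (inputLang l k).Relations j)
      (Fin k × Prop × Prop) (max φ.rank ψ.rank)) + 2 * k) n G := by
  have := shallow_of_cover (m := m) (n := n) (k := k) (E := FormulaSucc (D :=
    (copy k (expand (incidence (completeTree m n)) Q)).Dom) φ ψ) (G := G)
    (c := 2 * Nat.card (ElementType (Σ j, (inputLang l k).Relations j)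
      (Fin k × Prop × Prop) (max φ.rank ψ.rank))) (fun u => ?_) n [] (by simp)
  · exact this.mono fun x hx => ⟨List.nil_prefix, hx⟩
  · refine ⟨{x ∈ G | ∃ y ∈ G, inputBlock u x ≠ inputBlock u y ∧
      FormulaSucc (D := (copy k (expand (incidence (completeTree m n)) Q)).Dom) φ ψ x y}, ?_, ?_⟩
    · refine ncard_cross_sources_le (D := (copy k (expand (incidence (completeTree m n)) Q)).Dom)
        (E := FormulaSucc φ ψ) (β := inputBlock u)
        (t := elementType (binRel (inputLang l k)
          (copy k (expand (incidence (completeTree m n)) Q)).Dom) (inputColour u) (inputBlock u)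
          (max φ.rank ψ.rank)) huniq ?_
      intro x _ x' _ y _ hxy hxy' ht
      -- The source is the first argument of `φ` but the second one of `ψ`, so the exchange is
      -- needed in both positions.
      obtain ⟨h1, h2⟩ := setType_univ_eq_of_elementType_eq (crossDetermined_input Q u) hxy hxy' ht
      exact Or.imp (MSO.sat_iff_of_setType_eq inputLang_arity _ φ (le_max_left _ _) h1).1
        (MSO.sat_iff_of_setType_eq inputLang_arity _ ψ (le_max_right _ _) h2).1
    · intro x hx y hy hZ hE
      by_contra h
      exact hZ ⟨hx, y, hy, h, hE⟩

end Input

theorem not_belowIn_completeTrees (n : ℕ) :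
    ¬ BelowIn (completeTrees (n + 1)) (completeTrees n) := by
  rintro ⟨τ, hτ⟩
  let φ := τ.basic.φ (graphInc 0 (by norm_num))
  let ψ := τ.basic.φ (graphInc 1 (by norm_num))
  -- The bound is fixed by `τ` alone, so the output tree can be given degree `c + 1` although the
  -- degree `m` of its preimage is unknown.
  let c := 2 * Nat.card (ElementType (Σ j, (inputLang τ.m τ.k).Relations j)
      (Fin τ.k × Prop × Prop) (max φ.rank ψ.rank)) + 2 * τ.k
  obtain ⟨B, hB, ⟨f⟩⟩ := hτ _ ⟨_, ⟨c + 1, rfl⟩, rfl⟩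
  simp only [Transduction.image, Set.mem_iUnion] at hB
  obtain ⟨_, ⟨_, ⟨m, rfl⟩, rfl⟩, Q, -, rfl⟩ := hB
  have hf : ∀ x y, TreeSucc x y ↔ FormulaSucc φ ψ (f x).1 (f y).1 := by
    intro x y
    rw [treeSucc_iff, ← f.map_rel, ← f.map_rel]
    refine or_congr ?_ ?_
    · refine iff_of_eq (congrArg (fun v => MSO.Holds φ v) (funext fun i => ?_))
      fin_cases i <;> rfl
    · refine iff_of_eq (congrArg (fun v => MSO.Holds ψ v) (funext fun i => ?_))
      fin_cases i <;> rfl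
  refine not_shallow_of_tree (Nat.lt_succ_self c) (f := fun x => (f x).1)
    (Subtype.val_injective.comp f.injective) (fun x y => (hf x y).1) n [] (by simp)
    (fun x _ => Set.mem_range_self x) (shallow_formulaSucc φ ψ Q _ ?_)
  -- Predecessors are unique on the range of `f`, which is the output domain, and need not be so on
  -- the rest of the input structure.
  rintro _ ⟨x, rfl⟩ _ ⟨x', rfl⟩ _ ⟨y, rfl⟩ h h'
  rw [((hf x y).2 h).unique ((hf x' y).2 h')]

/-! ### Restricting complete trees to smaller height -/

/-- The basic transduction that restricts a structure to its first parameter. -/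
def restrictBasic (L : FirstOrder.Language.{0, 0}) [L.IsRelational] [Finite L.Symbols] :
    BasicTransduction ((L.sum (paramLang 1)).sum (copyLang 1)) L where
  -- Atomic formulae need a variable, so this serves as the true sentence.
  χ := .ex (.subset 0 0)
  δ := .rel (k := 1) (Sum.inl (Sum.inr (ParamRel.pred 0))) id
  φ := fun {n} R => .rel (k := n) (Sum.inl (Sum.inl R)) id

/-- The transduction that restricts a structure to a guessed subset. -/
def restrictTransduction (L : FirstOrder.Language.{0, 0}) [L.IsRelational] [Finite L.Symbols] :
    Transduction L L where
  k := 1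
  one_le_k := le_rfl
  m := 1
  basic := restrictBasic L

section Restrict
variable {L : FirstOrder.Language.{0, 0}} [L.IsRelational] [Finite L.Symbols]

theorem restrictBasic_delta_iff {A : FinStr L} {Q : Fin 1 → Set A.Dom}
    (a : (copy 1 (expand A Q)).Dom) :
    (restrictBasic L).δ.Holds ![a] ↔ a.1 ∈ Q 0 := by
  constructor
  · rintro ⟨x, hx, p, c, hc, rfl⟩
    have h0 : (c 0, p) = a := hx 0
    subst h0
    exact hc
  · intro h
    refine ⟨![a], fun i => ?_, a.2, ![a.1], h, ?_⟩
    · fin_cases i; rfl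
    · funext i
      fin_cases i; rfl

theorem restrictBasic_phi_iff {A : FinStr L} {Q : Fin 1 → Set A.Dom} {n : ℕ}
    (R : L.Relations n) (a : Fin n → A.Dom) :
    ((restrictBasic L).φ R).Holds (A := (copy 1 (expand A Q)).Dom)
      (fun i => ((a i, 0) : A.Dom × Fin 1)) ↔ Structure.RelMap R a := by
  constructor
  · rintro ⟨x, hx, p, c, hc, rfl⟩
    have : a = c := funext fun i => (congrArg Prod.fst (hx i : (c i, p) = (a i, 0))).symm
    rw [this]
    exact hc
  · exact fun h => ⟨_, fun i => rfl, 0, a, h, rfl⟩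

/-- A structure that embeds into a structure `A` is a value of the restriction transduction. -/
theorem exists_mem_values_restrictTransduction {A B : FinStr L} (f : B.Dom ↪[L] A.Dom) :
    ∃ B' ∈ (restrictTransduction L).values A, Nonempty (B.Dom ≃[L] B'.Dom) := by
  refine ⟨_, ⟨fun _ => Set.range f, ⟨∅, fun _ h => h⟩, rfl⟩, ⟨?_⟩⟩
  refine
    { toEquiv := Equiv.ofBijective (fun b => ⟨((f b, 0) : A.Dom × Fin 1),
        (restrictBasic_delta_iff _).2 (Set.mem_range_self b)⟩) ⟨?_, ?_⟩
      map_fun' := fun F => isEmptyElim F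
      map_rel' := fun R x => ?_ }
  · intro b b' h
    exact f.injective (congrArg (fun z => z.1.1) h)
  · rintro ⟨⟨a, p⟩, ha⟩
    obtain ⟨b, rfl⟩ := (restrictBasic_delta_iff _).1 ha
    exact ⟨b, Subtype.ext (Prod.ext rfl (Subsingleton.elim (α := Fin 1) _ _))⟩
  · exact (restrictBasic_phi_iff R _).trans (f.map_rel R x)

end Restrict

/-! ### Embedding the incidence structure of a complete tree into that of the next height -/

theorem relMap_pred_iff {m n k : ℕ} {R : FirstOrder.Language.graph.Relations k}
    (x : Fin 1 → (incidence (completeTree m n)).Dom) :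
    Structure.RelMap (L := incLang FirstOrder.Language.graph) (IncRel.pred R) x ↔
      Sum.isLeft (x 0) = false := by
  cases R
  constructor
  · rintro ⟨c, h, hx⟩
    exact congrArg Sum.isLeft hx
  · intro h
    rcases treeVertex_or_treeEdge (x 0) with ⟨w, hw, e⟩ | ⟨w, d, hw, e⟩
    · rw [e] at h
      exact absurd h Bool.true_eq_false.mp
    · exact ⟨_, ⟨d, rfl⟩, e⟩

/-- Words and the distinction between vertices and edges determine the incidence relations without
reference to the height. The inclusion preserves both, so it preserves and reflects the relations.
-/
theorem relMap_inc_iff_treeWord {m n i : ℕ} {h} (x : Fin 2 → (incidence (completeTree m n)).Dom) :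
    Structure.RelMap (L := incLang FirstOrder.Language.graph) (IncRel.inc i h) x ↔
      Sum.isLeft (x 0) = true ∧ Sum.isLeft (x 1) = false ∧
        (i = 0 ∧ (∃ d, treeWord (x 1) = treeWord (x 0) ++ [d]) ∨
          i = 1 ∧ treeWord (x 1) = treeWord (x 0)) := by
  rw [relMap_inc_iff]
  constructor
  · rintro ⟨w, d, h, h', h1, ⟨rfl, h0⟩ | ⟨rfl, h0⟩⟩ <;> rw [h0, h1]
    · exact ⟨rfl, rfl, Or.inl ⟨rfl, d, rfl⟩⟩
    · exact ⟨rfl, rfl, Or.inr ⟨rfl, rfl⟩⟩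
  · rcases treeVertex_or_treeEdge (x 0) with ⟨w, h0, e0⟩ | ⟨w, d, h0, e0⟩ <;>
      rcases treeVertex_or_treeEdge (x 1) with ⟨v, h1, e1⟩ | ⟨v, c, h1, e1⟩ <;>
        rw [e0, e1]
    · exact fun h => absurd h.2.1 Bool.true_eq_false.mp
    · rintro ⟨-, -, ⟨rfl, d, e⟩ | ⟨rfl, e⟩⟩
      · obtain ⟨rfl, -⟩ := List.append_inj' (e : v ++ [c] = w ++ [d]) rfl
        exact ⟨v, c, h1, h0, rfl, Or.inl ⟨rfl, rfl⟩⟩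
      · obtain rfl : v ++ [c] = w := e
        exact ⟨v, c, h1, by simp only [List.length_append, List.length_singleton] at h1; omega,
          rfl, Or.inr ⟨rfl, rfl⟩⟩
    · exact fun h => absurd h.2.1 Bool.true_eq_false.mp
    · exact fun h => absurd h.1.symm Bool.true_eq_false.mp

/-- The inclusion of the incidence structure of a complete tree into that of the next larger
height. -/
def treeInclusion (m n : ℕ) :
    (incidence (completeTree m n)).Dom → (incidence (completeTree m (n + 1))).Dom
  | .inl w => treeVertex w.1 (w.2.trans n.lt_succ_self)
  | .inr e => .inr ⟨⟨e.1.1, fun i => ⟨(e.1.2 i).1, (e.1.2 i).2.trans n.lt_succ_self⟩⟩, by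
      obtain ⟨⟨k, c⟩, R, hR⟩ := e
      cases R
      exact ⟨.adj, hR⟩⟩

@[simp] theorem treeWord_treeInclusion {m n : ℕ} (x : (incidence (completeTree m n)).Dom) :
    treeWord (treeInclusion m n x) = treeWord x := by
  cases x <;> rfl

@[simp] theorem isLeft_treeInclusion {m n : ℕ} (x : (incidence (completeTree m n)).Dom) :
    Sum.isLeft (treeInclusion m n x) = Sum.isLeft x := by
  cases x <;> rfl

/-- `treeInclusion` as an embedding of structures. -/
def incidenceTreeEmbedding (m n : ℕ) : (incidence (completeTree m n)).Dom
    ↪[incLang FirstOrder.Language.graph] (incidence (completeTree m (n + 1))).Dom where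
  toFun := treeInclusion m n
  inj' := by
    intro x y h
    refine treeWord_isLeft_injective (Prod.ext ?_ ?_)
    · simpa using congrArg treeWord h
    · simpa using congrArg (fun z => Sum.isLeft z) h
  map_fun' := fun F => isEmptyElim F
  map_rel' := by
    intro k R x
    cases R with
    | pred R => exact (relMap_pred_iff _).trans (by simp [relMap_pred_iff])
    | inc i h =>
      exact (relMap_inc_iff_treeWord _).trans (by simp [relMap_inc_iff_treeWord])

end MSOTrans

theorem mainTheorem5 (n : ℕ) :
    MSOTrans.StrictlyBelowIn (MSOTrans.completeTrees n) (MSOTrans.completeTrees (n + 1)) := by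
  refine ⟨⟨MSOTrans.restrictTransduction _, ?_⟩, MSOTrans.not_belowIn_completeTrees n⟩
  rintro _ ⟨_, ⟨m, rfl⟩, rfl⟩
  obtain ⟨B', hB', h⟩ := MSOTrans.exists_mem_values_restrictTransduction
    (MSOTrans.incidenceTreeEmbedding m n)
  refine ⟨B', ?_, h⟩
  simp only [MSOTrans.Transduction.image, Set.mem_iUnion]
  exact ⟨_, ⟨_, ⟨m, rfl⟩, rfl⟩, hB'⟩
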